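/- Let $(N_1,g_1)$ and $(N_2,g_2)$ be compact, connected smooth Riemannian manifolds without boundary, with Riemannian distance functions $d_1,d_2$. For $j=1,2$ let $M_j\subset N_j$ be open and put $F_j=N_j\setminus M_j$. Assume that $F_j$ has non-empty interior and that $F_j$ is a smooth manifold with smooth boundary, embedded in $N_j$ with the same dimension, such that $\partial F_j=\partial M_j$ (that is, near each point of the topological boundary of $F_j$ some smooth chart of $N_j$ straightens $F_j$ to a half-space). For $x\in N_j$ let $D^j_x\in C(F_j\times F_j)$ be the distance difference function $$D^j_x(z_1,z_2)=d_j(z_1,x)-d_j(z_2,x),\qquad z_1,z_2\in F_j .$$ Assume that there is a diffeomorphism $\phi:F_1\to F_2$ (smooth up to the boundary, with its inverse) such that $\phi^*(g_2|_{F_2})=g_1|_{F_1}$ and $$\{D^1_x\,;\ x\in M_1\}=\{D^2_y(\phi(\cdot),\phi(\cdot))\,;\ y\in M_2\}$$ as subsets of $C(F_1\times F_1)$. Then: (i) $d_1(z,w)=d_2(\phi(z),\phi(w))$ for all $z,w\in F_1$; (ii) $\{D^1_x\,;\ x\in N_1\}=\{D^2_y(\phi(\cdot),\phi(\cdot))\,;\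 y\in N_2\}$ as subsets of $C(F_1\times F_1)$. -/

import Mathlib

open Bundle
open scoped Manifold ContDiff

noncomputable section

/-- `F` is a smooth domain in the `n`-manifold `N`: a closed subset which is a smooth `n`-dimensional
manifold with boundary, embedded in `N`, whose boundary is the topological boundary of `F` in `N`.
Around each boundary point there is a smooth chart of `N` that straightens `F` to a half-space
(interior points of `F` need no condition: any chart of `N` inside `F` will do). -/
def IsSmoothDomain (n : ℕ) {N : Type*} [TopologicalSpace N]
    [ChartedSpace (EuclideanSpace ℝ (Fin n)) N] (F : Set N) : Prop :=
  IsClosed F ∧ ∀ p ∈ frontier F, ∃ e ∈ IsManifold.maximalAtlas (𝓡 n) ∞ N,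
    p ∈ e.source ∧ ∃ i : Fin n, ∀ x ∈ e.source, x ∈ F ↔ 0 ≤ (e x) i

/-- A diffeomorphism `F₁ → F₂` between subsets of manifolds (meant for smooth domains): a bijection
which, with its inverse, is `C^∞` on the set, up to the boundary. Only the values of `toFun` on `F₁`
and of `invFun` on `F₂` are relevant. -/
structure DomainDiffeo (n₁ n₂ : ℕ) {N₁ N₂ : Type*}
    [TopologicalSpace N₁] [ChartedSpace (EuclideanSpace ℝ (Fin n₁)) N₁]
    [TopologicalSpace N₂] [ChartedSpace (EuclideanSpace ℝ (Fin n₂)) N₂]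
    (F₁ : Set N₁) (F₂ : Set N₂) extends PartialEquiv N₁ N₂ where
  source_eq : source = F₁
  target_eq : target = F₂
  contMDiffOn_toFun : ContMDiffOn (𝓡 n₁) (𝓡 n₂) ∞ toFun F₁
  contMDiffOn_invFun : ContMDiffOn (𝓡 n₂) (𝓡 n₁) ∞ invFun F₂

namespace DomainDiffeo

/-- The underlying homeomorphism `F₁ → F₂`. -/
def toHomeomorph {n₁ n₂ : ℕ} {N₁ N₂ : Type*}
    [TopologicalSpace N₁] [ChartedSpace (EuclideanSpace ℝ (Fin n₁)) N₁]
    [TopologicalSpace N₂] [ChartedSpace (EuclideanSpace ℝ (Fin n₂)) N₂]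
    {F₁ : Set N₁} {F₂ : Set N₂} (φ : DomainDiffeo n₁ n₂ F₁ F₂) : F₁ ≃ₜ F₂ where
  toFun x := ⟨φ.toFun x, φ.target_eq.le (φ.map_source (φ.source_eq.ge x.2))⟩
  invFun y := ⟨φ.invFun y, φ.source_eq.le (φ.map_target (φ.target_eq.ge y.2))⟩
  left_inv x := Subtype.ext (φ.left_inv (φ.source_eq.ge x.2))
  right_inv y := Subtype.ext (φ.right_inv (φ.target_eq.ge y.2))
  continuous_toFun :=
    (continuousOn_iff_continuous_domRestrict.1 φ.contMDiffOn_toFun.continuousOn).subtype_mk _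
  continuous_invFun :=
    (continuousOn_iff_continuous_domRestrict.1 φ.contMDiffOn_invFun.continuousOn).subtype_mk _

/-- `φ^* g₂ = g₁` on `F₁`. The derivative at `x ∈ F₁` is taken within `F₁`, so that it depends only
on the values of `φ` on `F₁`; on a smooth domain it is uniquely determined. -/
def PreservesMetric {n₁ n₂ : ℕ} {N₁ N₂ : Type*}
    [TopologicalSpace N₁] [ChartedSpace (EuclideanSpace ℝ (Fin n₁)) N₁] [IsManifold (𝓡 n₁) ∞ N₁]
    [RiemannianBundle (fun x : N₁ ↦ TangentSpace (𝓡 n₁) x)]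
    [TopologicalSpace N₂] [ChartedSpace (EuclideanSpace ℝ (Fin n₂)) N₂] [IsManifold (𝓡 n₂) ∞ N₂]
    [RiemannianBundle (fun x : N₂ ↦ TangentSpace (𝓡 n₂) x)]
    {F₁ : Set N₁} {F₂ : Set N₂} (φ : DomainDiffeo n₁ n₂ F₁ F₂) : Prop :=
  ∀ x ∈ F₁, ∀ v w : TangentSpace (𝓡 n₁) x,
    inner ℝ (mfderivWithin (𝓡 n₁) (𝓡 n₂) φ.toFun F₁ x v)
      (mfderivWithin (𝓡 n₁) (𝓡 n₂) φ.toFun F₁ x w) = inner ℝ v w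

/-- The pullback `D(φ(·), φ(·)) ∈ C(F₁ × F₁)` of `D ∈ C(F₂ × F₂)`. -/
def pullback {n₁ n₂ : ℕ} {N₁ N₂ : Type*}
    [TopologicalSpace N₁] [ChartedSpace (EuclideanSpace ℝ (Fin n₁)) N₁]
    [TopologicalSpace N₂] [ChartedSpace (EuclideanSpace ℝ (Fin n₂)) N₂]
    {F₁ : Set N₁} {F₂ : Set N₂} (φ : DomainDiffeo n₁ n₂ F₁ F₂) (D : C(F₂ × F₂, ℝ)) :
    C(F₁ × F₁, ℝ) where
  toFun p := D (φ.toHomeomorph p.1, φ.toHomeomorph p.2)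
  continuous_toFun := by
    have := φ.toHomeomorph.continuous
    fun_prop

end DomainDiffeo

/-- The distance difference function `D_x(z₁, z₂) = d(z₁, x) - d(z₂, x)` on `F × F`. -/
def distDiff {N : Type*} [MetricSpace N] (F : Set N) (x : N) : C(F × F, ℝ) where
  toFun p := dist (p.1 : N) x - dist (p.2 : N) x
  continuous_toFun := by fun_prop

end

/-!
Write `φ` for the diffeomorphism `F₁ → F₂`.

Let `z ∈ F₁` and `b ∈ frontier F₁`. By the triangle inequality `|D_x(z, b)| ≤ d₁(z, b)`, and
`|D_x(z, b)| → d₁(z, b)` as `x ∈ M₁` tends to `b`. Hence `d₁(z, b)` is the supremum of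
`|D_x(z, b)|` over `x ∈ M₁`, a quantity determined by the data, and `φ` preserves `d(z, b)` as soon
as it maps the frontier of `F₁` onto that of `F₂` (`dist_le_dist_of_mem_closure`).

The latter is the inverse function theorem: at interior points the derivatives of `φ` and `φ⁻¹`
preserve norms, so they are injective; as both interiors are non-empty, the dimensions agree, the
derivatives are bijective and interior points go to interior points
(`mem_interior_of_norm_mfderiv_eq`).

For arbitrary `z, w ∈ F₁`, take an almost minimizing path from `z` to `w` in `N₁`. Either it meets
the frontier at some `b`, and `d(z, b)`, `d(b, w)` are already controlled; or it stays in the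
interior of `F₁`, and its image under `φ` has the same length. So `φ` does not increase distances
(`dist_le_dist_of_norm_mfderiv_eq`), and the same holds for `φ⁻¹`. Once `φ` is known to preserve
distances, it carries the functions `D_x` with `x ∈ F₁` to those with `y = φ x ∈ F₂`.
-/

open Manifold Set Filter Topology

/-! ### The inverse function theorem on boundaryless manifolds -/

theorem map_nhds_eq_of_surjective_mfderiv
    {E E' H H' M M' : Type*} [NormedAddCommGroup E] [NormedSpace ℝ E] [CompleteSpace E]
    [NormedAddCommGroup E'] [NormedSpace ℝ E'] [CompleteSpace E']
    [TopologicalSpace H] [TopologicalSpace H']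
    {I : ModelWithCorners ℝ E H} {I' : ModelWithCorners ℝ E' H'} [I.Boundaryless]
    [I'.Boundaryless] [TopologicalSpace M] [TopologicalSpace M'] [ChartedSpace H M]
    [ChartedSpace H' M'] {f : M → M'} {x : M} {n : ℕ∞ω} (hn : n ≠ 0)
    (hf : ContMDiffAt I I' n f x) (hsurj : Function.Surjective (mfderiv I I' f x)) :
    map f (𝓝 x) = 𝓝 (f x) := by
  have hd : MDifferentiableAt I I' f x := hf.mdifferentiableAt hn
  obtain ⟨hcont, hcd⟩ := contMDiffAt_iff.1 hf
  simp only [I.range_eq_univ, contDiffWithinAt_univ] at hcd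
  have hs := hcd.hasStrictFDerivAt hn
  have hder : fderiv ℝ (extChartAt I' (f x) ∘ f ∘ (extChartAt I x).symm) (extChartAt I x x) =
      mfderiv I I' f x := by
    rw [hd.mfderiv, I.range_eq_univ, fderivWithin_univ]
    rfl
  have hmap := hs.map_nhds_eq_of_surj (LinearMap.range_eq_top.2 (hder ▸ hsurj))
  have hsymm := map_extChartAt_symm_nhdsWithin_range (I := I) x
  rw [I.range_eq_univ, nhdsWithin_univ] at hsymm
  rw [← map_map, ← map_map, hsymm] at hmap
  have hval : (extChartAt I' (f x) ∘ f ∘ (extChartAt I x).symm) (extChartAt I x x) =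
      extChartAt I' (f x) (f x) := by simp
  rw [hval] at hmap
  have hsymm' := map_extChartAt_symm_nhdsWithin_range (I := I') (f x)
  rw [I'.range_eq_univ, nhdsWithin_univ] at hsymm'
  rw [← hsymm', ← hmap, map_map]
  refine (map_congr ?_)
  filter_upwards [hcont (extChartAt_source_mem_nhds (I := I') (f x))] with y hy
  exact ((extChartAt I' (f x)).left_inv hy).symm

/-! ### Paths and distance differences near the frontier -/

theorem exists_mem_frontier_or_subset_interior {X : Type*} [TopologicalSpace X] {F : Set X}
    {γ : ℝ → X} (hγ : ContinuousOn γ (Icc 0 1)) (h0 : γ 0 ∈ F) :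
    (∃ t ∈ Icc (0 : ℝ) 1, γ t ∈ frontier F) ∨ ∀ t ∈ Icc (0 : ℝ) 1, γ t ∈ interior F := by
  by_cases h : ∃ t ∈ Icc (0 : ℝ) 1, γ t ∈ frontier F
  · exact Or.inl h
  refine Or.inr ?_
  push Not at h
  have hsub : γ '' Icc 0 1 ⊆ interior F ∪ interior Fᶜ := by
    rintro _ ⟨t, ht, rfl⟩
    have := h t ht
    rw [← compl_frontier_eq_union_interior]
    exact this
  have h01 : (0 : ℝ) ∈ Icc (0 : ℝ) 1 := by simp
  have h0i : γ 0 ∈ interior F := by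
    rcases hsub (mem_image_of_mem γ h01) with h' | h'
    · exact h'
    · exact absurd h0 (interior_subset h')
  have := (isPreconnected_Icc.image γ hγ).subset_left_of_subset_union isOpen_interior
    isOpen_interior (disjoint_compl_right.mono interior_subset interior_subset) hsub
    ⟨_, mem_image_of_mem γ h01, h0i⟩
  exact fun t ht ↦ this (mem_image_of_mem γ ht)

/-- If every function `dist · y`, `y ∈ M`, has the same differences along `f` as some function
`dist · x`, then letting `y ∈ M` tend to `f b` bounds `dist (f z) (f b)`. -/
theorem dist_le_dist_of_mem_closure {X Y : Type*} [PseudoMetricSpace X] [PseudoMetricSpace Y]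
    {M : Set Y} {f : X → Y} {z b : X} (hb : f b ∈ closure M)
    (h : ∀ y ∈ M, ∃ x, dist (f z) y - dist (f b) y = dist z x - dist b x) :
    dist (f z) (f b) ≤ dist z b := by
  have hcl : closure M ⊆ {y | dist (f z) y - dist (f b) y ≤ dist z b} := by
    refine closure_minimal (fun y hy ↦ ?_)
      (isClosed_le (by fun_prop) continuous_const)
    obtain ⟨x, hx⟩ := h y hy
    have := dist_triangle z b x
    change dist (f z) y - dist (f b) y ≤ dist z b
    linarith
  simpa using hcl hb

/-! ### Maps with norm-preserving derivative -/

section Riemannian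

variable {n₁ n₂ : ℕ} {N₁ N₂ : Type*}
  [MetricSpace N₁] [ChartedSpace (EuclideanSpace ℝ (Fin n₁)) N₁]
  [RiemannianBundle (fun x : N₁ ↦ TangentSpace (𝓡 n₁) x)]
  [MetricSpace N₂] [ChartedSpace (EuclideanSpace ℝ (Fin n₂)) N₂]
  [RiemannianBundle (fun x : N₂ ↦ TangentSpace (𝓡 n₂) x)]

theorem injective_mfderiv_of_norm_eq {f : N₁ → N₂} {x : N₁}
    (hiso : ∀ v : TangentSpace (𝓡 n₁) x, ‖mfderiv (𝓡 n₁) (𝓡 n₂) f x v‖ = ‖v‖) :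
    Function.Injective (mfderiv (𝓡 n₁) (𝓡 n₂) f x) := by
  refine (injective_iff_map_eq_zero _).2 fun v hv ↦ ?_
  have h := hiso v
  rw [hv, norm_zero] at h
  exact norm_eq_zero.1 h.symm

theorem dim_le_of_norm_mfderiv_eq {f : N₁ → N₂} {x : N₁}
    (hiso : ∀ v : TangentSpace (𝓡 n₁) x, ‖mfderiv (𝓡 n₁) (𝓡 n₂) f x v‖ = ‖v‖) : n₁ ≤ n₂ := by
  let L : EuclideanSpace ℝ (Fin n₁) →L[ℝ] EuclideanSpace ℝ (Fin n₂) :=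
    mfderiv (𝓡 n₁) (𝓡 n₂) f x
  have h := LinearMap.finrank_le_finrank_of_injective (f := L.toLinearMap)
    (injective_mfderiv_of_norm_eq hiso)
  simpa using h

theorem mem_interior_of_norm_mfderiv_eq {F₁ : Set N₁} {F₂ : Set N₂} {f : N₁ → N₂} {x : N₁}
    (hn : n₁ = n₂) (hf : ContMDiffOn (𝓡 n₁) (𝓡 n₂) ∞ f F₁) (hmaps : MapsTo f F₁ F₂)
    (hx : x ∈ interior F₁)
    (hiso : ∀ v : TangentSpace (𝓡 n₁) x, ‖mfderiv (𝓡 n₁) (𝓡 n₂) f x v‖ = ‖v‖) :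
    f x ∈ interior F₂ := by
  have hnhds := mem_interior_iff_mem_nhds.1 hx
  let L : EuclideanSpace ℝ (Fin n₁) →L[ℝ] EuclideanSpace ℝ (Fin n₂) :=
    mfderiv (𝓡 n₁) (𝓡 n₂) f x
  have hsurj : Function.Surjective L :=
    (LinearMap.injective_iff_surjective_of_finrank_eq_finrank (f := L.toLinearMap)
      (by simp [hn])).1 (injective_mfderiv_of_norm_eq hiso)
  rw [mem_interior_iff_mem_nhds,
    ← map_nhds_eq_of_surjective_mfderiv (by simp) (hf.contMDiffAt hnhds) hsurj]
  exact mem_map.2 (mem_of_superset hnhds hmaps)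

/-- A map that is isometric to first order in the interior of `F` and does not increase distances
to the frontier of `F` does not increase distances between points of `F`; the distances are those
of the ambient manifolds, so minimizing paths may leave `F`. -/
theorem dist_le_dist_of_norm_mfderiv_eq [IsRiemannianManifold (𝓡 n₁) N₁]
    [IsRiemannianManifold (𝓡 n₂) N₂] {F : Set N₁} {f : N₁ → N₂}
    (hf : ContMDiffOn (𝓡 n₁) (𝓡 n₂) ∞ f F)
    (hiso : ∀ x ∈ interior F, ∀ v : TangentSpace (𝓡 n₁) x,
      ‖mfderiv (𝓡 n₁) (𝓡 n₂) f x v‖ = ‖v‖)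
    (hfr : ∀ z ∈ F, ∀ b ∈ frontier F, dist (f z) (f b) ≤ dist z b)
    {z w : N₁} (hz : z ∈ F) (hw : w ∈ F) : dist (f z) (f w) ≤ dist z w := by
  have hfr' : ∀ z ∈ F, ∀ b ∈ frontier F, edist (f z) (f b) ≤ edist z b := by
    intro z hz b hb
    rw [edist_dist, edist_dist]
    exact ENNReal.ofReal_le_ofReal (hfr z hz b hb)
  suffices h : edist (f z) (f w) ≤ edist z w by
    rw [edist_dist, edist_dist] at h
    exact (ENNReal.ofReal_le_ofReal_iff dist_nonneg).1 h
  refine le_of_forall_gt fun r hr ↦ ?_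
  rw [IsRiemannianManifold.out (I := 𝓡 n₁) z w] at hr
  obtain ⟨γ, h0, h1, hγ, hlen⟩ := exists_lt_of_riemannianEDist_lt hr
  refine lt_of_le_of_lt ?_ hlen
  rcases exists_mem_frontier_or_subset_interior hγ.continuousOn (h0 ▸ hz) with
    ⟨t, ht, hb⟩ | hint
  · have hzb : edist z (γ t) ≤ pathELength (𝓡 n₁) γ 0 t := by
      rw [IsRiemannianManifold.out (I := 𝓡 n₁)]
      exact riemannianEDist_le_pathELength (hγ.mono (Icc_subset_Icc le_rfl ht.2)) h0 rfl ht.1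
    have hbw : edist (γ t) w ≤ pathELength (𝓡 n₁) γ t 1 := by
      rw [IsRiemannianManifold.out (I := 𝓡 n₁)]
      exact riemannianEDist_le_pathELength (hγ.mono (Icc_subset_Icc ht.1 le_rfl)) rfl h1 ht.2
    calc edist (f z) (f w) ≤ edist (f z) (f (γ t)) + edist (f w) (f (γ t)) :=
          edist_triangle_right _ _ _
      _ ≤ edist z (γ t) + edist w (γ t) := add_le_add (hfr' z hz _ hb) (hfr' w hw _ hb)
      _ ≤ pathELength (𝓡 n₁) γ 0 t + pathELength (𝓡 n₁) γ t 1 :=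
          add_le_add hzb (edist_comm w _ ▸ hbw)
      _ = pathELength (𝓡 n₁) γ 0 1 := pathELength_add ht.1 ht.2
  · have hsm : ContMDiffOn 𝓘(ℝ, ℝ) (𝓡 n₂) 1 (f ∘ γ) (Icc 0 1) :=
      (hf.of_le (by norm_num)).comp hγ
        fun t ht ↦ interior_subset (s := F) (hint t ht)
    have hle : edist (f z) (f w) ≤ pathELength (𝓡 n₂) (f ∘ γ) 0 1 := by
      rw [IsRiemannianManifold.out (I := 𝓡 n₂)]
      exact riemannianEDist_le_pathELength hsm (by simp [h0]) (by simp [h1]) zero_le_one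
    refine hle.trans_eq ?_
    rw [pathELength_eq_lintegral_mfderiv_Ioo, pathELength_eq_lintegral_mfderiv_Ioo]
    refine MeasureTheory.setLIntegral_congr_fun measurableSet_Ioo fun t ht ↦ ?_
    have hti := hint t (Ioo_subset_Icc_self ht)
    have hfd : MDifferentiableAt (𝓡 n₁) (𝓡 n₂) f (γ t) :=
      (hf.contMDiffAt (mem_interior_iff_mem_nhds.1 hti)).mdifferentiableAt (by simp)
    have hγd : MDifferentiableAt 𝓘(ℝ, ℝ) (𝓡 n₁) γ t :=
      (hγ.contMDiffAt (Icc_mem_nhds ht.1 ht.2)).mdifferentiableAt (by simp)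
    have hcomp := (hfd.hasMFDerivAt.comp t hγd.hasMFDerivAt).mfderiv
    have h2 := hiso _ hti (mfderiv 𝓘(ℝ, ℝ) (𝓡 n₁) γ t 1)
    simp only [hcomp]
    rw [← ofReal_norm, ← ofReal_norm]
    exact congrArg ENNReal.ofReal h2

/-! ### Diffeomorphisms of domains that preserve the metric -/

namespace DomainDiffeo

variable [IsManifold (𝓡 n₁) ∞ N₁] [IsManifold (𝓡 n₂) ∞ N₂]
  {F₁ : Set N₁} {F₂ : Set N₂} {φ : DomainDiffeo n₁ n₂ F₁ F₂}

theorem PreservesMetric.norm_mfderivWithin (hφ : φ.PreservesMetric) {x : N₁} (hx : x ∈ F₁)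
    (v : TangentSpace (𝓡 n₁) x) :
    ‖mfderivWithin (𝓡 n₁) (𝓡 n₂) φ.toFun F₁ x v‖ = ‖v‖ := by
  rw [@norm_eq_sqrt_real_inner _ _ _ (mfderivWithin (𝓡 n₁) (𝓡 n₂) φ.toFun F₁ x v),
    norm_eq_sqrt_real_inner v, hφ x hx v v]

theorem PreservesMetric.norm_mfderiv (hφ : φ.PreservesMetric) {x : N₁} (hx : x ∈ interior F₁)
    (v : TangentSpace (𝓡 n₁) x) : ‖mfderiv (𝓡 n₁) (𝓡 n₂) φ.toFun x v‖ = ‖v‖ := by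
  rw [← mfderivWithin_of_mem_nhds (mem_interior_iff_mem_nhds.1 hx)]
  exact hφ.norm_mfderivWithin (interior_subset hx) v

/-- Differentiate `φ ∘ φ⁻¹ = id` at `y`. The point `φ⁻¹ y` is only known to lie in `F₁`, possibly on
its frontier, so the derivative of `φ` there is the one within `F₁`. -/
theorem PreservesMetric.norm_mfderiv_invFun (hφ : φ.PreservesMetric) {y : N₂}
    (hy : y ∈ interior F₂) (v : TangentSpace (𝓡 n₂) y) :
    ‖mfderiv (𝓡 n₂) (𝓡 n₁) φ.invFun y v‖ = ‖v‖ := by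
  have hmaps : MapsTo φ.invFun F₂ F₁ := fun y hy ↦
    φ.source_eq.le (φ.map_target (φ.target_eq.ge hy))
  have hyF := interior_subset hy
  have hnhds : F₂ ∈ 𝓝 y := mem_interior_iff_mem_nhds.1 hy
  have hg : MDifferentiableAt (𝓡 n₂) (𝓡 n₁) φ.invFun y :=
    (φ.contMDiffOn_invFun.contMDiffAt hnhds).mdifferentiableAt (by simp)
  have hf : MDifferentiableWithinAt (𝓡 n₁) (𝓡 n₂) φ.toFun F₁ (φ.invFun y) :=
    (φ.contMDiffOn_toFun _ (hmaps hyF)).mdifferentiableWithinAt (by simp)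
  have hright : φ.toFun (φ.invFun y) = y := φ.right_inv (φ.target_eq.ge hyF)
  have hcomp := (hf.hasMFDerivWithinAt.comp y hg.hasMFDerivAt.hasMFDerivWithinAt
    (s := F₂) hmaps).hasMFDerivAt hnhds
  have hid : HasMFDerivAt (𝓡 n₂) (𝓡 n₂) (φ.toFun ∘ φ.invFun) y
      (ContinuousLinearMap.id ℝ (TangentSpace (𝓡 n₂) y)) :=
    (hasMFDerivAt_id y).congr_of_eventuallyEq
      (by filter_upwards [hnhds] with u hu using φ.right_inv (φ.target_eq.ge hu))
  have hnorm := hφ.norm_mfderivWithin (hmaps hyF) (mfderiv (𝓡 n₂) (𝓡 n₁) φ.invFun y v)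
  have heq : mfderivWithin (𝓡 n₁) (𝓡 n₂) φ.toFun F₁ (φ.invFun y)
      (mfderiv (𝓡 n₂) (𝓡 n₁) φ.invFun y v) = v :=
    congrArg (fun L : EuclideanSpace ℝ (Fin n₂) →L[ℝ] EuclideanSpace ℝ (Fin n₂) ↦ L v)
      (hasMFDerivAt_unique hcomp hid)
  -- The fibres over `φ (φ⁻¹ y)` and over `y` carry propositionally equal norms.
  have hfib : ∀ (y' : N₂), y' = y → ∀ u : EuclideanSpace ℝ (Fin n₂),
      ‖(show TangentSpace (𝓡 n₂) y' from u)‖ = ‖(show TangentSpace (𝓡 n₂) y from u)‖ := by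
    rintro _ rfl u
    rfl
  exact hnorm.symm.trans ((hfib _ hright _).trans
    (congrArg (fun u : TangentSpace (𝓡 n₂) y ↦ ‖u‖) heq))

end DomainDiffeo
end Riemannian

theorem proposition1p1
    {n₁ n₂ : ℕ} {N₁ N₂ : Type*}
    -- compact connected smooth Riemannian manifolds without boundary, with Riemannian distance
    [MetricSpace N₁] [CompactSpace N₁] [ConnectedSpace N₁]
    [ChartedSpace (EuclideanSpace ℝ (Fin n₁)) N₁] [IsManifold (𝓡 n₁) ∞ N₁]
    [RiemannianBundle (fun x : N₁ ↦ TangentSpace (𝓡 n₁) x)]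
    [IsContMDiffRiemannianBundle (𝓡 n₁) ∞ (EuclideanSpace ℝ (Fin n₁))
      (fun x : N₁ ↦ TangentSpace (𝓡 n₁) x)]
    [IsRiemannianManifold (𝓡 n₁) N₁]
    [MetricSpace N₂] [CompactSpace N₂] [ConnectedSpace N₂]
    [ChartedSpace (EuclideanSpace ℝ (Fin n₂)) N₂] [IsManifold (𝓡 n₂) ∞ N₂]
    [RiemannianBundle (fun x : N₂ ↦ TangentSpace (𝓡 n₂) x)]
    [IsContMDiffRiemannianBundle (𝓡 n₂) ∞ (EuclideanSpace ℝ (Fin n₂))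
      (fun x : N₂ ↦ TangentSpace (𝓡 n₂) x)]
    [IsRiemannianManifold (𝓡 n₂) N₂]
    -- the open sets and their complements
    (M₁ : Set N₁) (M₂ : Set N₂) (hM₁ : IsOpen M₁) (hM₂ : IsOpen M₂)
    (F₁ : Set N₁) (F₂ : Set N₂) (hF₁ : F₁ = M₁ᶜ) (hF₂ : F₂ = M₂ᶜ)
    (hint₁ : (interior F₁).Nonempty) (hint₂ : (interior F₂).Nonempty)
    (hdom₁ : IsSmoothDomain n₁ F₁) (hdom₂ : IsSmoothDomain n₂ F₂)
    -- the equivalence of the distance difference data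
    (φ : DomainDiffeo n₁ n₂ F₁ F₂) (hφ : φ.PreservesMetric)
    (hdata : {D | ∃ x ∈ M₁, D = distDiff F₁ x} =
      {D | ∃ y ∈ M₂, D = φ.pullback (distDiff F₂ y)}) :
    (∀ z w : F₁, dist (z : N₁) (w : N₁) =
      dist (φ.toHomeomorph z : N₂) (φ.toHomeomorph w : N₂)) ∧
    {D | ∃ x : N₁, D = distDiff F₁ x} =
      {D | ∃ y : N₂, D = φ.pullback (distDiff F₂ y)} := by
  have hmaps : MapsTo φ.toFun F₁ F₂ := fun x hx ↦
    φ.target_eq.le (φ.map_source (φ.source_eq.ge hx))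
  have hmaps' : MapsTo φ.invFun F₂ F₁ := fun y hy ↦
    φ.source_eq.le (φ.map_target (φ.target_eq.ge hy))
  have hleft : ∀ x ∈ F₁, φ.invFun (φ.toFun x) = x := fun x hx ↦
    φ.left_inv (φ.source_eq.ge hx)
  have hright : ∀ y ∈ F₂, φ.toFun (φ.invFun y) = y := fun y hy ↦
    φ.right_inv (φ.target_eq.ge hy)
  have hcl₁ : frontier F₁ ⊆ closure M₁ := by
    rw [hF₁, frontier_compl]
    exact frontier_subset_closure
  have hcl₂ : frontier F₂ ⊆ closure M₂ := by
    rw [hF₂, frontier_compl]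
    exact frontier_subset_closure
  have hn : n₁ = n₂ := le_antisymm
    (dim_le_of_norm_mfderiv_eq (hφ.norm_mfderiv hint₁.some_mem))
    (dim_le_of_norm_mfderiv_eq (hφ.norm_mfderiv_invFun hint₂.some_mem))
  have hfr : ∀ b ∈ frontier F₁, φ.toFun b ∈ frontier F₂ := fun b hb ↦ by
    have hbF := hdom₁.1.frontier_subset hb
    refine ⟨subset_closure (hmaps hbF), fun hi ↦ hb.2 ?_⟩
    rw [← hleft b hbF]
    exact mem_interior_of_norm_mfderiv_eq hn.symm φ.contMDiffOn_invFun hmaps' hi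
      (hφ.norm_mfderiv_invFun hi)
  have hfr' : ∀ b ∈ frontier F₂, φ.invFun b ∈ frontier F₁ := fun b hb ↦ by
    have hbF := hdom₂.1.frontier_subset hb
    refine ⟨subset_closure (hmaps' hbF), fun hi ↦ hb.2 ?_⟩
    rw [← hright b hbF]
    exact mem_interior_of_norm_mfderiv_eq hn φ.contMDiffOn_toFun hmaps hi (hφ.norm_mfderiv hi)
  have hdist : ∀ z w : F₁, dist (z : N₁) (w : N₁) =
      dist (φ.toHomeomorph z : N₂) (φ.toHomeomorph w : N₂) := by
    intro z w
    refine le_antisymm ?_ ?_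
    · have h := dist_le_dist_of_norm_mfderiv_eq φ.contMDiffOn_invFun
        (fun y hy ↦ hφ.norm_mfderiv_invFun hy) (fun z hz b hb ↦
          dist_le_dist_of_mem_closure (hcl₁ (hfr' b hb)) fun x hx ↦ ?_)
        (hmaps z.2) (hmaps w.2)
      · rwa [hleft _ z.2, hleft _ w.2] at h
      · obtain ⟨y, -, hy⟩ := hdata.subset ⟨x, hx, rfl⟩
        have hbF := hdom₂.1.frontier_subset hb
        have h := DFunLike.congr_fun hy (⟨_, hmaps' hz⟩, ⟨_, hmaps' hbF⟩)
        change dist (φ.invFun z) x - dist (φ.invFun b) x =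
          dist (φ.toFun (φ.invFun z)) y - dist (φ.toFun (φ.invFun b)) y at h
        rw [hright _ hz, hright _ hbF] at h
        exact ⟨y, h⟩
    · refine dist_le_dist_of_norm_mfderiv_eq φ.contMDiffOn_toFun
        (fun x hx ↦ hφ.norm_mfderiv hx) (fun z hz b hb ↦
          dist_le_dist_of_mem_closure (hcl₂ (hfr b hb)) fun y hy ↦ ?_) z.2 w.2
      obtain ⟨x, -, hx⟩ := hdata.symm.subset ⟨y, hy, rfl⟩
      exact ⟨x, (DFunLike.congr_fun hx (⟨z, hz⟩, ⟨b, hdom₁.1.frontier_subset hb⟩) :)⟩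
  -- The functions `D_x` with `x ∈ F₁` correspond to those with `y = φ x ∈ F₂`.
  have hpull : ∀ x : F₁, distDiff F₁ (x : N₁) =
      φ.pullback (distDiff F₂ (φ.toHomeomorph x : N₂)) := fun x ↦
    ContinuousMap.ext fun p ↦ congrArg₂ (· - ·) (hdist p.1 x) (hdist p.2 x)
  refine ⟨hdist, Subset.antisymm ?_ ?_⟩
  · rintro _ ⟨x, rfl⟩
    by_cases hx : x ∈ M₁
    · obtain ⟨y, -, hy⟩ := hdata.subset ⟨x, hx, rfl⟩
      exact ⟨y, hy⟩
    · exact ⟨_, hpull ⟨x, hF₁.ge hx⟩⟩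
  · rintro _ ⟨y, rfl⟩
    by_cases hy : y ∈ M₂
    · obtain ⟨x, -, hx⟩ := hdata.symm.subset ⟨y, hy, rfl⟩
      exact ⟨x, hx⟩
    · obtain ⟨x, hx⟩ := φ.toHomeomorph.surjective ⟨y, hF₂.ge hy⟩
      refine ⟨x, ?_⟩
      rw [hpull x, hx]
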